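/- **Setting.** Let $M$ be an $n$-dimensional smooth manifold (Hausdorff, second countable), $G$ a Lie group with Lie algebra $\mathfrak g$, and $\pi:P\to M$ a smooth principal $G$-bundle. Write $\Omega^k_{he}(P;\mathfrak g)$ for the real vector space of smooth, horizontal, $G$-equivariant $\mathfrak g$-valued $k$-forms on $P$, $\Omega^1_{eq}(P;\mathfrak g)$ for the smooth equivariant $1$-forms, $\operatorname{Conn}(P;\mathfrak g)\subset\Omega^1_{eq}(P;\mathfrak g)$ for the set of connection $1$-forms, $F_D=d_DD\in\Omega^2_{he}(P;\mathfrak g)$ for the field strength of a connection $D$, and $\operatorname{Dens}(M)$ for the smooth $1$-densities on $M$. A *Yang–Mills-type (YMT) theory* is an $\mathbb R$-bilinear pairing $\langle\cdot,\cdot\rangle:\Omega^2_{he}(P;\mathfrak g)\times\Omega^2_{he}(P;\mathfrak g)\to\operatorname{Dens}(M)$ such that $\langle F_D,F_D\rangle$ is integrable for every $D$; its action functional is $S^G:\operatorname{Conn}(P;\mathfrak g)\to\mathbb R$, $S^G(D)=\int_M\langle F_D,F_D\rangle$. A *basic extension* of $G$ is an injective Lie group homomorphism $\imath:G\hookrightarrow\hat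 G$. Let $\hat P\to M$ be the induced principal $\hat G$-bundle $P\times_G\hat G$ (with its $\imath$-equivariant map $P\to\hat P$ over $M$), $\hat{\mathfrak g}$ the Lie algebra of $\hat G$, and $\operatorname{Gau}=\operatorname{Gau}_{\hat G}(\hat P)$ the group of automorphisms of $\hat P$ over $\mathrm{id}_M$, acting on forms by pullback. For a set $X$ of $1$-forms on $\hat P$ and $S:X\to\mathbb R$, $X$ is an *invariant subset for $S$* if $X$ and $S$ are $\operatorname{Gau}$-invariant, and an *injective invariant subset for $S$* if moreover the induced map $\overline S:X/\operatorname{Gau}\to\mathbb R$ is injective. An *extension* of $S^G$ relative to $\imath$ consists of: a set $X$ (extended domain) with $\operatorname{Conn}(\hat P;\hat{\mathfrak g})\subseteq X\subseteq\Omega^1_{eq}(\hat P;\hat{\mathfrak g})$ and a functional $\hat S:X\to\mathbb R$ for which $X$ is an invariant subset; a subset $C^1\subseteq X$ (correction subspace, possibly empty); and maps $C:C^1\to\mathbb R$, $\delta:C^1\to\operatorname{Conn}(P;\mathfrak g)$ with $\hat S|_{C^1}=S^G\circ\delta+C$. It *realizes* a functional $S$ on a set of forms if that set is its extended domain and $S$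 is its functional $\hat S$. It is *complete* if $C=0$, and *injective* if $X$ is an injective invariant subset for $\hat S$. A *gauge fixing* is a section $\sigma$ of the projection $\operatorname{Conn}(\hat P;\hat{\mathfrak g})\to\operatorname{Conn}(\hat P;\hat{\mathfrak g})/\operatorname{Gau}$. For an invariant subset $X\supseteq\operatorname{Conn}(\hat P;\hat{\mathfrak g})$ for $S$, let $\overline S_{\jmath}:\operatorname{Conn}(\hat P;\hat{\mathfrak g})/\operatorname{Gau}\to X/\operatorname{Gau}\to\mathbb R$ be the functional induced by $S$, let $$\operatorname{Pb}(S^G,\overline S_{\jmath})=\{(D,o): D\in\operatorname{Conn}(P;\mathfrak g),\ o\in\operatorname{Conn}(\hat P;\hat{\mathfrak g})/\operatorname{Gau},\ S^G(D)=\overline S_{\jmath}(o)\},$$ and let $X(\sigma)=\{\sigma(o):(D,o)\in\operatorname{Pb}(S^G,\overline S_{\jmath})\}\subseteq X$ be the image of this pullback under $\sigma$. An extension is *of pullback type* if it is complete and injective and $C^1\subseteq X(\sigma)$ for some gauge fixing $\sigma$. Let $\operatorname{Inj}(S^G;\hat G)$ and $\operatorname{Pb}(S^G;\hat G)$ be the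 classes of injective and of pullback-type extensions, and $\operatorname{Coh}(S^G;\hat G)=\operatorname{Inj}(S^G;\hat G)\cap\operatorname{Pb}(S^G;\hat G)$. **Corollary (obstruction for Coh).** For every YMT theory $S^G$, every basic extension $\imath:G\hookrightarrow\hat G$, every set $X$ with $\operatorname{Conn}(\hat P;\hat{\mathfrak g})\subseteq X\subseteq\Omega^1_{eq}(\hat P;\hat{\mathfrak g})$ and every functional $S:X\to\mathbb R$: 1. $S$ is realized by an extension in $\operatorname{Coh}(S^G;\hat G)$ if and only if it is realized by an extension in $\operatorname{Inj}(S^G;\hat G)$. 2. $S$ is realized by an extension in $\operatorname{Inj}(S^G;\hat G)$ if and only if $X$ is an injective $\operatorname{Gau}_{\hat G}(\hat P)$-invariant subset for $S$. 3. If $X$ is an injective $\operatorname{Gau}_{\hat G}(\hat P)$-invariant subset for $S$, then for every gauge fixing $\sigma$ in $\operatorname{Conn}(\hat P;\hat{\mathfrak g})$ there is an extension in $\operatorname{Coh}(S^G;\hat G)$ that realizes $S$ and has correction subspace $X(\sigma)$. -/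

import Mathlib

open scoped Manifold ContDiff
open Set

noncomputable section
namespace YangMillsType

section Calculus

variable {E E' E'' V : Type*} [NormedAddCommGroup E] [NormedSpace ℝ E]
  [NormedAddCommGroup E'] [NormedSpace ℝ E'] [NormedAddCommGroup E''] [NormedSpace ℝ E'']
  [NormedAddCommGroup V] [NormedSpace ℝ V]
  {P Q R : Type*} [TopologicalSpace P] [ChartedSpace E P] [TopologicalSpace Q] [ChartedSpace E' Q]
  [TopologicalSpace R] [ChartedSpace E'' R]

/-- The differential of a map of manifolds at a point. (The tangent space of a manifold at any
point is, by definition in Mathlib, the model vector space.) -/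
def dAt (f : P → Q) (p : P) : E →L[ℝ] E' := mfderiv 𝓘(ℝ, E) 𝓘(ℝ, E') f p

theorem dAt_id (p : P) : dAt (E := E) (E' := E) (id : P → P) p = ContinuousLinearMap.id ℝ E :=
  mfderiv_id

theorem dAt_comp {g : Q → R} {f : P → Q} (p : P)
    (hg : MDifferentiableAt 𝓘(ℝ, E') 𝓘(ℝ, E'') g (f p))
    (hf : MDifferentiableAt 𝓘(ℝ, E) 𝓘(ℝ, E') f p) :
    dAt (E := E) (E' := E'') (g ∘ f) p
      = (dAt (E := E') (E' := E'') g (f p)).comp (dAt (E := E) (E' := E') f p) :=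
  mfderiv_comp p hg hf

theorem dAt_eq_fderiv (f : E → E') (x : E) : dAt (E := E) (E' := E') f x = fderiv ℝ f x :=
  mfderiv_eq_fderiv

/-- A (not necessarily smooth) `V`-valued differential `k`-form on the manifold `P`. -/
abbrev Form (E P V : Type*) [NormedAddCommGroup E] [NormedSpace ℝ E]
    [NormedAddCommGroup V] [NormedSpace ℝ V] (k : ℕ) :=
  P → E [⋀^Fin k]→L[ℝ] V

/-- The pullback `f^* η`. -/
def pullback {k : ℕ} (f : P → Q) (η : Form E' Q V k) : Form E P V k :=
  fun p => (η (f p)).compContinuousLinearMap (dAt (E := E) (E' := E') f p)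

/-- The representation of a form in a chart `e`, i.e. its pullback along `e.symm`. -/
def chartRep {k : ℕ} (η : Form E P V k) (e : OpenPartialHomeomorph P E) :
    E → E [⋀^Fin k]→L[ℝ] V :=
  fun x => (η (e.symm x)).compContinuousLinearMap (dAt (E := E) (E' := E) e.symm x)

/-- A form is smooth if its components in every preferred chart are smooth functions. -/
def IsSmoothForm {k : ℕ} (η : Form E P V k) : Prop :=
  ∀ (q : P) (v : Fin k → E),
    ContDiffOn ℝ ∞ (fun x => chartRep η (chartAt E q) x v) (chartAt E q).target

/-- The exterior derivative of a form: at `p` it is computed in the preferred chart at `p`. -/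
def extD {k : ℕ} (η : Form E P V k) : Form E P V (k + 1) :=
  fun p => (extDeriv (chartRep η (chartAt E p)) (chartAt E p p)).compContinuousLinearMap
    (dAt (E := E) (E' := E) (chartAt E p) p)

theorem pullback_id {k : ℕ} (η : Form E P V k) :
    pullback (E := E) (E' := E) (id : P → P) η = η := by
  funext p
  simp only [pullback, dAt_id]
  ext v
  simp

theorem pullback_comp {k : ℕ} {g : Q → R} {f : P → Q}
    (hg : MDifferentiable 𝓘(ℝ, E') 𝓘(ℝ, E'') g) (hf : MDifferentiable 𝓘(ℝ, E) 𝓘(ℝ, E') f)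
    (η : Form E'' R V k) :
    pullback (E := E) (E' := E'') (g ∘ f) η
      = pullback (E := E) (E' := E') f (pullback (E := E') (E' := E'') g η) := by
  funext p
  simp only [pullback, dAt_comp p (hg _) (hf _)]
  ext v
  simp [Function.comp_def]

theorem extDeriv_chartRep_pullback [IsManifold 𝓘(ℝ, E) ∞ P] [IsManifold 𝓘(ℝ, E') ∞ Q] {k : ℕ}
    {f : P → Q} (hf : ContMDiff 𝓘(ℝ, E) 𝓘(ℝ, E') ∞ f) (η : Form E' Q V k)
    {e : OpenPartialHomeomorph P E} (he : e ∈ atlas E P)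
    {e' : OpenPartialHomeomorph Q E'} (he' : e' ∈ atlas E' Q)
    (hη : DifferentiableOn ℝ (chartRep η e') e'.target)
    {p : P} (hp : p ∈ e.source) (hp' : f p ∈ e'.source) :
    extDeriv (chartRep (pullback (E := E) (E' := E') f η) e) (e p)
      = (extDeriv (chartRep η e') (e' (f p))).compContinuousLinearMap
          (fderiv ℝ (e' ∘ f ∘ e.symm) (e p)) := by
  have he₁ : e ∈ IsManifold.maximalAtlas 𝓘(ℝ, E) ∞ P := IsManifold.subset_maximalAtlas he
  have he₂ : e' ∈ IsManifold.maximalAtlas 𝓘(ℝ, E') ∞ Q := IsManifold.subset_maximalAtlas he'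
  set F : E → E' := e' ∘ f ∘ e.symm with hF
  have hes : ∀ x ∈ e.target, ContMDiffAt 𝓘(ℝ, E) 𝓘(ℝ, E) ∞ e.symm x := fun x hx =>
    (contMDiffOn_symm_of_mem_maximalAtlas he₁).contMDiffAt (e.open_target.mem_nhds hx)
  have hes' : ∀ x ∈ e'.target, ContMDiffAt 𝓘(ℝ, E') 𝓘(ℝ, E') ∞ e'.symm x := fun x hx =>
    (contMDiffOn_symm_of_mem_maximalAtlas he₂).contMDiffAt (e'.open_target.mem_nhds hx)
  have hFs : ∀ x ∈ e.target, f (e.symm x) ∈ e'.source → ContMDiffAt 𝓘(ℝ, E) 𝓘(ℝ, E') ∞ F x :=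
    fun x hx hx' => ((contMDiffOn_of_mem_maximalAtlas he₂).contMDiffAt
      (e'.open_source.mem_nhds hx')).comp x ((hf _).comp x (hes x hx))
  have hpt : e p ∈ e.target := e.map_source hp
  have hcont : ContinuousAt (f ∘ e.symm) (e p) :=
    ((hf _).comp (e p) (hes _ hpt)).continuousAt
  have hnear : ∀ᶠ x in nhds (e p), x ∈ e.target ∧ f (e.symm x) ∈ e'.source := by
    refine Filter.Eventually.and (e.open_target.mem_nhds hpt) (hcont.preimage_mem_nhds ?_)
    exact e'.open_source.mem_nhds (by simpa [e.left_inv hp] using hp')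
  have hFp : F (e p) = e' (f p) := by simp [hF, e.left_inv hp]
  have key : chartRep (pullback (E := E) (E' := E') f η) e =ᶠ[nhds (e p)]
      fun x => (chartRep η e' (F x)).compContinuousLinearMap (fderiv ℝ F x) := by
    filter_upwards [hnear.eventually_nhds] with x hx
    obtain ⟨hx1, hx2⟩ := hx.self_of_nhds
    have hinv : e'.symm (F x) = f (e.symm x) := by simp [hF, e'.left_inv hx2]
    have hd : (dAt (E := E') (E' := E') e'.symm (F x)).comp (fderiv ℝ F x)
        = (dAt (E := E) (E' := E') f (e.symm x)).comp (dAt (E := E) (E' := E) e.symm x) := by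
      rw [← dAt_eq_fderiv, ← dAt_comp, ← dAt_comp]
      · have : (e'.symm ∘ F) =ᶠ[nhds x] (f ∘ e.symm) := by
          filter_upwards [hx] with y hy
          simp [hF, e'.left_inv hy.2]
        exact this.mfderiv_eq
      · exact (hf _).mdifferentiableAt (by simp)
      · exact (hes x hx1).mdifferentiableAt (by simp)
      · exact (hes' _ (e'.map_source hx2)).mdifferentiableAt (by simp)
      · exact (hFs x hx1 hx2).mdifferentiableAt (by simp)
    ext v
    have hd' : ∀ u, dAt (E := E') (E' := E') e'.symm (F x) (fderiv ℝ F x u)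
        = dAt (E := E) (E' := E') f (e.symm x) (dAt (E := E) (E' := E) e.symm x u) :=
      fun u => DFunLike.congr_fun hd u
    simp only [chartRep, pullback, ContinuousAlternatingMap.compContinuousLinearMap_apply,
      Function.comp_def, hd', hinv]
  rw [key.extDeriv_eq, extDeriv_pullback (r := ∞), hFp]
  · rw [hFp]
    exact (hη _ (e'.map_source hp')).differentiableAt (e'.open_target.mem_nhds (e'.map_source hp'))
  · exact (contMDiffAt_iff_contDiffAt).1 (hFs _ hpt (by simpa [e.left_inv hp] using hp'))
  · simp only [minSmoothness_of_isRCLikeNormedField]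
    exact WithTop.coe_le_coe.2 (le_top : (2 : ℕ∞) ≤ ⊤)

theorem extD_eq_chart [IsManifold 𝓘(ℝ, E) ∞ P] {k : ℕ} (η : Form E P V k)
    (hη : ∀ q, DifferentiableOn ℝ (chartRep η (chartAt E q)) (chartAt E q).target)
    {p q : P} (hp : p ∈ (chartAt E q).source) :
    extDeriv (chartRep η (chartAt E q)) (chartAt E q p)
      = (extD η p).compContinuousLinearMap (dAt (E := E) (E' := E) (chartAt E q).symm (chartAt E q p)) := by
  have h := extDeriv_chartRep_pullback (E := E) (E' := E) (f := (id : P → P)) contMDiff_id η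
    (chart_mem_atlas E q) (chart_mem_atlas E p) (hη p) hp (mem_chart_source E p)
  rw [pullback_id] at h
  have he₁ := IsManifold.chart_mem_maximalAtlas (I := 𝓘(ℝ, E)) (n := ∞) q
  have he₂ := IsManifold.chart_mem_maximalAtlas (I := 𝓘(ℝ, E)) (n := ∞) p
  rw [h, ← dAt_eq_fderiv, Function.id_comp, dAt_comp (E' := E), (chartAt E q).left_inv hp]
  · ext v
    simp [extD, Function.comp_def]
  · rw [(chartAt E q).left_inv hp]
    exact ((contMDiffOn_of_mem_maximalAtlas he₂).contMDiffAt
      ((chartAt E p).open_source.mem_nhds (mem_chart_source E p))).mdifferentiableAt (by simp)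
  · exact ((contMDiffOn_symm_of_mem_maximalAtlas he₁).contMDiffAt
      ((chartAt E q).open_target.mem_nhds ((chartAt E q).map_source hp))).mdifferentiableAt (by simp)

theorem extD_pullback [IsManifold 𝓘(ℝ, E) ∞ P] [IsManifold 𝓘(ℝ, E') ∞ Q] {k : ℕ}
    {f : P → Q} (hf : ContMDiff 𝓘(ℝ, E) 𝓘(ℝ, E') ∞ f) (η : Form E' Q V k)
    (hη : ∀ q, DifferentiableOn ℝ (chartRep η (chartAt E' q)) (chartAt E' q).target) :
    extD (pullback (E := E) (E' := E') f η) = pullback (E := E) (E' := E') f (extD η) := by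
  funext p
  have he₁ := IsManifold.chart_mem_maximalAtlas (I := 𝓘(ℝ, E)) (n := ∞) p
  have he₂ := IsManifold.chart_mem_maximalAtlas (I := 𝓘(ℝ, E')) (n := ∞) (f p)
  have hp := mem_chart_source E p
  have m1 : MDifferentiableAt 𝓘(ℝ, E) 𝓘(ℝ, E) (chartAt E p) p :=
    ((contMDiffOn_of_mem_maximalAtlas he₁).contMDiffAt
      ((chartAt E p).open_source.mem_nhds hp)).mdifferentiableAt (by simp)
  have m2 : MDifferentiableAt 𝓘(ℝ, E') 𝓘(ℝ, E') (chartAt E' (f p)) (f p) :=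
    ((contMDiffOn_of_mem_maximalAtlas he₂).contMDiffAt
      ((chartAt E' (f p)).open_source.mem_nhds (mem_chart_source E' (f p)))).mdifferentiableAt
      (by simp)
  have m3 : MDifferentiableAt 𝓘(ℝ, E) 𝓘(ℝ, E) (chartAt E p).symm (chartAt E p p) :=
    ((contMDiffOn_symm_of_mem_maximalAtlas he₁).contMDiffAt
      ((chartAt E p).open_target.mem_nhds ((chartAt E p).map_source hp))).mdifferentiableAt (by simp)
  have m4 : MDifferentiableAt 𝓘(ℝ, E) 𝓘(ℝ, E') f p := (hf p).mdifferentiableAt (by simp)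
  have h := extDeriv_chartRep_pullback hf η (chart_mem_atlas E p) (chart_mem_atlas E' (f p))
    (hη (f p)) hp (mem_chart_source E' (f p))
  have hd : (fderiv ℝ (chartAt E' (f p) ∘ f ∘ (chartAt E p).symm) (chartAt E p p)).comp
      (dAt (E := E) (E' := E) (chartAt E p) p)
      = (dAt (E := E') (E' := E') (chartAt E' (f p)) (f p)).comp (dAt (E := E) (E' := E') f p) := by
    rw [← dAt_eq_fderiv, ← dAt_comp p m2 m4, ← dAt_comp p _ m1]
    · refine Filter.EventuallyEq.mfderiv_eq ?_
      filter_upwards [(chartAt E p).open_source.mem_nhds hp] with y hy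
      simp [(chartAt E p).left_inv hy]
    · have m4' : MDifferentiableAt 𝓘(ℝ, E) 𝓘(ℝ, E') f ((chartAt E p).symm (chartAt E p p)) := by
        rwa [(chartAt E p).left_inv hp]
      have m2' : MDifferentiableAt 𝓘(ℝ, E') 𝓘(ℝ, E') (chartAt E' (f p))
          ((f ∘ (chartAt E p).symm) (chartAt E p p)) := by
        simpa [(chartAt E p).left_inv hp] using m2
      exact m2'.comp _ (m4'.comp _ m3)
  have hd' : ∀ u, fderiv ℝ (chartAt E' (f p) ∘ f ∘ (chartAt E p).symm) (chartAt E p p)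
      (dAt (E := E) (E' := E) (chartAt E p) p u)
      = dAt (E := E') (E' := E') (chartAt E' (f p)) (f p) (dAt (E := E) (E' := E') f p u) :=
    fun u => DFunLike.congr_fun hd u
  have hd'' : ∀ v : Fin (k + 1) → E,
      (fderiv ℝ (chartAt E' (f p) ∘ f ∘ (chartAt E p).symm) (chartAt E p p)) ∘
        (dAt (E := E) (E' := E) (chartAt E p) p) ∘ v
      = dAt (E := E') (E' := E') (chartAt E' (f p)) (f p) ∘ dAt (E := E) (E' := E') f p ∘ v :=
    fun v => funext fun i => hd' (v i)
  ext v
  simp only [extD] at h ⊢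
  simp only [pullback] at h ⊢
  simp only [h, ContinuousAlternatingMap.compContinuousLinearMap_apply, hd'']
  rfl

/-- `1`-alternating maps are linear maps. -/
abbrev oneFormLIE (E V : Type*) [NormedAddCommGroup E] [NormedSpace ℝ E]
    [NormedAddCommGroup V] [NormedSpace ℝ V] : (E →L[ℝ] V) ≃ₗᵢ[ℝ] (E [⋀^Fin 1]→L[ℝ] V) :=
  ContinuousAlternatingMap.ofSubsingletonLIE (𝕜 := ℝ) (E := E) (F := V) (ι := Fin 1) (0 : Fin 1)

/-- The value of a `1`-form at a point, as a linear map. -/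
def toLin (a : E [⋀^Fin 1]→L[ℝ] V) : E →L[ℝ] V :=
  (oneFormLIE E V).symm a

theorem toLin_apply (a : E [⋀^Fin 1]→L[ℝ] V) (u : E) : toLin a u = a (fun _ => u) := rfl

theorem IsSmoothForm.contDiffOn_toLin [FiniteDimensional ℝ E] {η : Form E P V 1}
    (hη : IsSmoothForm η) (q : P) :
    ContDiffOn ℝ ∞ (fun x => toLin (chartRep η (chartAt E q) x)) (chartAt E q).target := by
  rw [contDiffOn_clm_apply]
  intro u
  exact hη q (fun _ => u)

theorem IsSmoothForm.contDiffOn [FiniteDimensional ℝ E] {η : Form E P V 1}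
    (hη : IsSmoothForm η) (q : P) :
    ContDiffOn ℝ ∞ (chartRep η (chartAt E q)) (chartAt E q).target := by
  simpa [Function.comp_def, toLin] using
    (oneFormLIE E V).contDiff.comp_contDiffOn (hη.contDiffOn_toLin q)

theorem extDeriv_one_apply {a : E → E [⋀^Fin 1]→L[ℝ] V} {x : E} (ha : DifferentiableAt ℝ a x)
    (v : Fin 2 → E) :
    extDeriv a x v = fderiv ℝ (fun y => toLin (a y)) x (v 0) (v 1)
      - fderiv ℝ (fun y => toLin (a y)) x (v 1) (v 0) := by
  have h : ∀ u w, fderiv ℝ (fun y => toLin (a y)) x u w = fderiv ℝ a x u (fun _ => w) := by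
    intro u w
    have h1 : HasFDerivAt (fun y => toLin (a y))
        (((oneFormLIE E V).symm :
          (E [⋀^Fin 1]→L[ℝ] V) →L[ℝ] (E →L[ℝ] V)).comp (fderiv ℝ a x)) x :=
      ((oneFormLIE E V).symm.toContinuousLinearEquiv.hasFDerivAt).comp x ha.hasFDerivAt
    rw [h1.fderiv]
    rfl
  have h0 : (Fin.removeNth (0 : Fin 2) v) = fun _ => v 1 := by
    funext i; fin_cases i; rfl
  have h1 : (Fin.removeNth (1 : Fin 2) v) = fun _ => v 0 := by
    funext i; fin_cases i; rfl
  rw [extDeriv_apply ha, h, h, Fin.sum_univ_two, h0, h1,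
    fderiv_continuousAlternatingMap_apply_const_apply ha,
    fderiv_continuousAlternatingMap_apply_const_apply ha]
  simp [sub_eq_add_neg]

end Calculus

section Bundles

variable {EM EG EP V M G P : Type*}
  [NormedAddCommGroup EM] [NormedSpace ℝ EM] [NormedAddCommGroup EG] [NormedSpace ℝ EG]
  [NormedAddCommGroup EP] [NormedSpace ℝ EP]
  [TopologicalSpace M] [ChartedSpace EM M]
  [TopologicalSpace G] [ChartedSpace EG G] [Group G]
  [TopologicalSpace P] [ChartedSpace EP P]

/-- A smooth principal `G`-bundle `P → M`. Local triviality is expressed by a smooth local section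
`s` and a smooth "group coordinate" `τ`, so that `(x, g) ↦ s x · g` and `p ↦ (π p, τ p)` are
mutually inverse equivariant diffeomorphisms `U × G ≃ π⁻¹ U`. -/
structure PrincipalBundle (EM EG EP M G P : Type*)
    [NormedAddCommGroup EM] [NormedSpace ℝ EM] [NormedAddCommGroup EG] [NormedSpace ℝ EG]
    [NormedAddCommGroup EP] [NormedSpace ℝ EP]
    [TopologicalSpace M] [ChartedSpace EM M]
    [TopologicalSpace G] [ChartedSpace EG G] [Group G]
    [TopologicalSpace P] [ChartedSpace EP P] where
  proj : P → M
  /-- the right action of the structure group -/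
  act : P → G → P
  act_one : ∀ p, act p 1 = p
  act_mul : ∀ p g h, act p (g * h) = act (act p g) h
  proj_act : ∀ p g, proj (act p g) = proj p
  smooth_proj : ContMDiff 𝓘(ℝ, EP) 𝓘(ℝ, EM) ∞ proj
  smooth_act : ContMDiff (𝓘(ℝ, EP).prod 𝓘(ℝ, EG)) 𝓘(ℝ, EP) ∞ (fun x : P × G => act x.1 x.2)
  locally_trivial : ∀ x : M, ∃ U : Set M, IsOpen U ∧ x ∈ U ∧ ∃ (s : M → P) (τ : P → G),
    ContMDiffOn 𝓘(ℝ, EM) 𝓘(ℝ, EP) ∞ s U ∧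
    ContMDiffOn 𝓘(ℝ, EP) 𝓘(ℝ, EG) ∞ τ (proj ⁻¹' U) ∧
    (∀ y ∈ U, proj (s y) = y) ∧
    (∀ p, proj p ∈ U → act (s (proj p)) (τ p) = p) ∧
    (∀ y ∈ U, ∀ g, τ (act (s y) g) = g)

/-- The adjoint representation of a Lie group on its Lie algebra `𝔤 = T₁G`. -/
def Ad (g : G) : EG →L[ℝ] EG :=
  dAt (E := EG) (E' := EG) (fun h : G => g * h * g⁻¹) 1

namespace PrincipalBundle

variable (B : PrincipalBundle EM EG EP M G P)

theorem surjective_proj : Function.Surjective B.proj := by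
  intro x
  obtain ⟨U, -, hx, s, -, -, -, hs, -⟩ := B.locally_trivial x
  exact ⟨s x, hs x hx⟩

theorem exists_eq_act {p q : P} (h : B.proj p = B.proj q) : ∃ g, q = B.act p g := by
  obtain ⟨U, -, hx, s, τ, -, -, -, h2, -⟩ := B.locally_trivial (B.proj p)
  refine ⟨(τ p)⁻¹ * τ q, ?_⟩
  have hp := h2 p hx
  have hq := h2 q (h ▸ hx)
  rw [← h] at hq
  calc q = B.act (s (B.proj p)) (τ q) := hq.symm
    _ = B.act (B.act (s (B.proj p)) (τ p)) ((τ p)⁻¹ * τ q) := by rw [← B.act_mul]; simp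
    _ = _ := by rw [hp]

theorem act_free {p : P} {g h : G} (e : B.act p g = B.act p h) : g = h := by
  obtain ⟨U, -, hx, s, τ, -, -, -, h2, h3⟩ := B.locally_trivial (B.proj p)
  rw [← h2 p hx, ← B.act_mul, ← B.act_mul] at e
  have := congrArg τ e
  rw [h3 _ hx, h3 _ hx] at this
  exact mul_left_cancel this

/-- The fundamental vector `A^*_p`, i.e. the derivative at `1` of `g ↦ p · g` applied to
`A ∈ 𝔤 = T₁G`. The vertical vectors at `p` are exactly the vectors `A^*_p`. -/
def fund (p : P) : EG →L[ℝ] EP := dAt (E := EG) (E' := EP) (fun g : G => B.act p g) 1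

/-- Equivariance of a `𝔤`-valued form: `R_g^* η = Ad(g⁻¹) η`. -/
def IsEquivariant {k : ℕ} (η : Form EP P EG k) : Prop :=
  ∀ (p : P) (g : G) (v : Fin k → EP),
    pullback (E := EP) (E' := EP) (fun q => B.act q g) η p v = Ad g⁻¹ (η p v)

/-- A form is horizontal if it vanishes as soon as one of its arguments is vertical. -/
def IsHorizontal {k : ℕ} (η : Form EP P EG k) : Prop :=
  ∀ (p : P) (v : Fin k → EP), (∃ i, v i ∈ Set.range (B.fund p)) → η p v = 0

/-- `Ω^k_he(P; 𝔤)`: smooth, horizontal, equivariant `𝔤`-valued `k`-forms, as a real vector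
space. -/
def heForms (k : ℕ) : Submodule ℝ (Form EP P EG k) where
  carrier := {η | IsSmoothForm η ∧ B.IsHorizontal η ∧ B.IsEquivariant η}
  zero_mem' := by
    refine ⟨fun q v => ?_, fun p v _ => rfl, fun p g v => ?_⟩
    · exact contDiffOn_const (c := (0 : EG))
    · simp [pullback]
  add_mem' := by
    rintro a b ⟨h1, h2, h3⟩ ⟨k1, k2, k3⟩
    refine ⟨fun q v => (h1 q v).add (k1 q v), fun p v hv => ?_, fun p g v => ?_⟩
    · simp [h2 p v hv, k2 p v hv]
    · have h := h3 p g v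
      have k := k3 p g v
      simp only [pullback, ContinuousAlternatingMap.compContinuousLinearMap_apply] at h k ⊢
      simp [h, k]
  smul_mem' := by
    rintro c a ⟨h1, h2, h3⟩
    refine ⟨fun q v => (h1 q v).const_smul c, fun p v hv => ?_, fun p g v => ?_⟩
    · simp [h2 p v hv]
    · have h := h3 p g v
      simp only [pullback, ContinuousAlternatingMap.compContinuousLinearMap_apply] at h ⊢
      simp [h]

/-- `Ω^1_eq(P; 𝔤)`: smooth equivariant `𝔤`-valued `1`-forms. -/
def eqOneForms : Set (Form EP P EG 1) := {η | IsSmoothForm η ∧ B.IsEquivariant η}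

/-- `Conn(P; 𝔤)`: connection `1`-forms, i.e. smooth equivariant `𝔤`-valued `1`-forms `D` with
`D(A^*) = A`. -/
def Conn : Set (Form EP P EG 1) :=
  {D | D ∈ B.eqOneForms ∧ ∀ (p : P) (A : EG), D p (fun _ => B.fund p A) = A}

/-- The horizontal projection `T_p P → T_p P`, `v ↦ v - (D v)^*`, of a connection `D`. -/
def hor (D : Form EP P EG 1) (p : P) : EP →L[ℝ] EP :=
  ContinuousLinearMap.id ℝ EP - (B.fund p).comp (toLin (D p))

/-- The exterior covariant derivative `d_D η = (dη)(h ·, …, h ·)`, with `h` the horizontal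
projection of `D`. -/
def covD {k : ℕ} (D : Form EP P EG 1) (η : Form EP P EG k) : Form EP P EG (k + 1) :=
  fun p => (extD η p).compContinuousLinearMap (B.hor D p)

/-- The field strength `F_D = d_D D`. -/
def curvature (D : Form EP P EG 1) : Form EP P EG 2 := B.covD D D

theorem smooth_act_left [IsManifold 𝓘(ℝ, EG) ∞ G] (p : P) :
    ContMDiff 𝓘(ℝ, EG) 𝓘(ℝ, EP) ∞ (fun g : G => B.act p g) :=
  B.smooth_act.comp (contMDiff_const.prodMk contMDiff_id)

theorem smooth_act_right (g : G) :
    ContMDiff 𝓘(ℝ, EP) 𝓘(ℝ, EP) ∞ (fun p : P => B.act p g) :=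
  B.smooth_act.comp (contMDiff_id.prodMk contMDiff_const)

theorem dAt_act_fund [LieGroup 𝓘(ℝ, EG) ∞ G] (p : P) (g : G) (A : EG) :
    dAt (E := EP) (E' := EP) (fun q => B.act q g) p (B.fund p A)
      = B.fund (B.act p g) (Ad g⁻¹ A) := by
  have h : (fun q => B.act q g) ∘ (fun h : G => B.act p h)
      = (fun h : G => B.act (B.act p g) h) ∘ (fun h : G => g⁻¹ * h * g⁻¹⁻¹) := by
    funext h
    simp [← B.act_mul, mul_assoc]
  have hc : ContMDiff 𝓘(ℝ, EG) 𝓘(ℝ, EG) ∞ (fun h : G => g⁻¹ * h * g⁻¹⁻¹) :=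
    (contMDiff_const.mul contMDiff_id).mul contMDiff_const
  have h1 := dAt_comp (E := EG) (E' := EP) (E'' := EP) (1 : G)
    ((B.smooth_act_right g _).mdifferentiableAt (by simp))
    ((B.smooth_act_left p 1).mdifferentiableAt (by simp))
  have h2 := dAt_comp (E := EG) (E' := EG) (E'' := EP) (1 : G)
    ((B.smooth_act_left (B.act p g) (g⁻¹ * 1 * g⁻¹⁻¹)).mdifferentiableAt (by simp))
    ((hc 1).mdifferentiableAt (by simp))
  rw [h, h2] at h1
  have h3 := DFunLike.congr_fun h1 A
  simp only [ContinuousLinearMap.comp_apply] at h3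
  rw [B.act_one] at h3
  simp only [fund, Ad]
  rw [← h3]
  simp

theorem curvature_isHorizontal {D : Form EP P EG 1} (hD : D ∈ B.Conn) :
    B.IsHorizontal (B.curvature D) := by
  rintro p v ⟨i, A, hA⟩
  have h0 : B.hor D p (v i) = 0 := by
    have := hD.2 p A
    simp [hor, ← hA, toLin_apply, this]
  simp only [curvature, covD, ContinuousAlternatingMap.compContinuousLinearMap_apply]
  exact (extD D p).map_coord_zero i h0

theorem curvature_isEquivariant [FiniteDimensional ℝ EP] [IsManifold 𝓘(ℝ, EP) ∞ P]
    [LieGroup 𝓘(ℝ, EG) ∞ G] {D : Form EP P EG 1} (hD : D ∈ B.Conn) :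
    B.IsEquivariant (B.curvature D) := by
  intro p g v
  have hdiff : ∀ q, DifferentiableOn ℝ (chartRep D (chartAt EP q)) (chartAt EP q).target :=
    fun q => (hD.1.1.contDiffOn q).differentiableOn (by simp)
  have h1 : ∀ u : EP, B.hor D (B.act p g) (dAt (E := EP) (E' := EP) (fun q => B.act q g) p u)
      = dAt (E := EP) (E' := EP) (fun q => B.act q g) p (B.hor D p u) := by
    intro u
    have h2 : D (B.act p g) (fun _ => dAt (E := EP) (E' := EP) (fun q => B.act q g) p u)
        = Ad g⁻¹ (D p (fun _ => u)) := hD.1.2 p g (fun _ => u)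
    simp [hor, toLin_apply, h2, dAt_act_fund]
  have h3 : pullback (E := EP) (E' := EP) (fun q => B.act q g) D
      = fun q => (Ad (EG := EG) g⁻¹).compContinuousAlternatingMap (D q) := by
    funext q; ext w
    exact hD.1.2 q g w
  have h4 := extD_pullback (B.smooth_act_right g) D hdiff
  have h5 : extD (fun q => (Ad (EG := EG) g⁻¹).compContinuousAlternatingMap (D q)) p
      = (Ad (EG := EG) g⁻¹).compContinuousAlternatingMap (extD D p) := by
    have hd := (hdiff p).differentiableAt
      ((chartAt EP p).open_target.mem_nhds ((chartAt EP p).map_source (mem_chart_source EP p)))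
    have hrep : chartRep (fun q => (Ad (EG := EG) g⁻¹).compContinuousAlternatingMap (D q))
        (chartAt EP p) = fun x => (Ad (EG := EG) g⁻¹).compContinuousAlternatingMap
          (chartRep D (chartAt EP p) x) := rfl
    have hd1 : DifferentiableAt ℝ (fun x => (Ad (EG := EG) g⁻¹).compContinuousAlternatingMap
        (chartRep D (chartAt EP p) x)) (chartAt EP p p) :=
      ((ContinuousLinearMap.compContinuousAlternatingMapCLM ℝ EP EG EG (ι := Fin 1)
        (Ad (EG := EG) g⁻¹)).differentiableAt.comp _ hd)
    have hd2 : DifferentiableAt ℝ (fun x => toLin (chartRep D (chartAt EP p) x))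
        (chartAt EP p p) :=
      ((hD.1.1.contDiffOn_toLin p).differentiableOn (by simp)).differentiableAt
        ((chartAt EP p).open_target.mem_nhds ((chartAt EP p).map_source (mem_chart_source EP p)))
    have hd3 : ∀ u w : EP, fderiv ℝ (fun x => toLin ((Ad (EG := EG) g⁻¹).compContinuousAlternatingMap
        (chartRep D (chartAt EP p) x))) (chartAt EP p p) u w
        = Ad g⁻¹ (fderiv ℝ (fun x => toLin (chartRep D (chartAt EP p) x)) (chartAt EP p p) u w) := by
      intro u w
      have := ((ContinuousLinearMap.compL ℝ EP EG EG (Ad (EG := EG) g⁻¹)).hasFDerivAt.comp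
        (chartAt EP p p) hd2.hasFDerivAt).fderiv
      exact DFunLike.congr_fun (DFunLike.congr_fun this u) w
    ext w
    simp only [extD, hrep, ContinuousAlternatingMap.compContinuousLinearMap_apply,
      ContinuousLinearMap.compContinuousAlternatingMap_coe, Function.comp_apply]
    rw [extDeriv_one_apply hd1, extDeriv_one_apply hd, hd3, hd3, map_sub]
  rw [h3] at h4
  have h6 := congr_fun h4 p
  rw [h5] at h6
  simp only [curvature, covD, pullback, ContinuousAlternatingMap.compContinuousLinearMap_apply]
  have h7 := DFunLike.congr_fun h6 (B.hor D p ∘ v)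
  simp only [pullback, ContinuousAlternatingMap.compContinuousLinearMap_apply] at h7
  refine Eq.trans ?_ h7.symm
  congr 1
  funext i
  exact h1 (v i)

theorem curvature_isSmooth [FiniteDimensional ℝ EP] [FiniteDimensional ℝ EG]
    [IsManifold 𝓘(ℝ, EP) ∞ P] [LieGroup 𝓘(ℝ, EG) ∞ G] {D : Form EP P EG 1} (hD : D ∈ B.Conn) :
    IsSmoothForm (B.curvature D) := by
  intro q v
  set e := chartAt EP q with he
  set φ := chartAt EG (1 : G) with hφ
  have he₁ : e ∈ IsManifold.maximalAtlas 𝓘(ℝ, EP) ∞ P := IsManifold.chart_mem_maximalAtlas q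
  have hφ₁ : φ ∈ IsManifold.maximalAtlas 𝓘(ℝ, EG) ∞ G := IsManifold.chart_mem_maximalAtlas 1
  have hφ1 : (1 : G) ∈ φ.source := mem_chart_source EG 1
  have hes : ∀ x ∈ e.target, ContMDiffAt 𝓘(ℝ, EP) 𝓘(ℝ, EP) ∞ e.symm x := fun x hx =>
    (contMDiffOn_symm_of_mem_maximalAtlas he₁).contMDiffAt (e.open_target.mem_nhds hx)
  have hec : ∀ p ∈ e.source, ContMDiffAt 𝓘(ℝ, EP) 𝓘(ℝ, EP) ∞ e p := fun p hp =>
    (contMDiffOn_of_mem_maximalAtlas he₁).contMDiffAt (e.open_source.mem_nhds hp)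
  have hφs : ContMDiffAt 𝓘(ℝ, EG) 𝓘(ℝ, EG) ∞ φ.symm (φ 1) :=
    (contMDiffOn_symm_of_mem_maximalAtlas hφ₁).contMDiffAt
      (φ.open_target.mem_nhds (φ.map_source hφ1))
  have hφc : ContMDiffAt 𝓘(ℝ, EG) 𝓘(ℝ, EG) ∞ φ 1 :=
    (contMDiffOn_of_mem_maximalAtlas hφ₁).contMDiffAt (φ.open_source.mem_nhds hφ1)
  -- the action read in charts
  let Φ : EP × EG → EP := fun z => e (B.act (e.symm z.1) (φ.symm z.2))
  have hΦ : ∀ x ∈ e.target, ContDiffAt ℝ ∞ Φ (x, φ 1) := by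
    intro x hx
    rw [← contMDiffAt_iff_contDiffAt, modelWithCornersSelf_prod, ← chartedSpaceSelf_prod]
    have h1 : ContMDiffAt (𝓘(ℝ, EP).prod 𝓘(ℝ, EG)) 𝓘(ℝ, EP) ∞
        (fun z : EP × EG => e.symm z.1) (x, φ 1) :=
      ContMDiffAt.comp (x, φ 1) (hes x hx) contMDiffAt_fst
    have h2 : ContMDiffAt (𝓘(ℝ, EP).prod 𝓘(ℝ, EG)) 𝓘(ℝ, EG) ∞
        (fun z : EP × EG => φ.symm z.2) (x, φ 1) :=
      ContMDiffAt.comp (x, φ 1) hφs contMDiffAt_snd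
    have h3 : ContMDiffAt (𝓘(ℝ, EP).prod 𝓘(ℝ, EG)) 𝓘(ℝ, EP) ∞
        (fun z : EP × EG => B.act (e.symm z.1) (φ.symm z.2)) (x, φ 1) :=
      ContMDiffAt.comp (x, φ 1) (B.smooth_act _) (h1.prodMk h2)
    have h4 : B.act (e.symm x) (φ.symm (φ 1)) ∈ e.source := by
      simpa [φ.left_inv hφ1, B.act_one] using e.map_target hx
    have h5 : ContMDiffAt (𝓘(ℝ, EP).prod 𝓘(ℝ, EG)) 𝓘(ℝ, EP) ∞ Φ (x, φ 1) :=
      ContMDiffAt.comp (x, φ 1) (hec _ h4) h3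
    exact h5
  let K : EP → EG →L[ℝ] EP := fun x =>
    (fderiv ℝ Φ (x, φ 1)).comp ((ContinuousLinearMap.inr ℝ EP EG).comp
      (dAt (E := EG) (E' := EG) φ (1 : G)))
  have hK : ContDiffOn ℝ ∞ K e.target := by
    intro x hx
    have h1 : ContDiffAt ℝ ∞ (fderiv ℝ Φ) (x, φ 1) :=
      (hΦ x hx).fderiv_right (m := ∞) (by simp)
    have h2 : ContDiffAt ℝ ∞ (fun y => fderiv ℝ Φ (y, φ 1)) x :=
      h1.comp x (contDiffAt_id.prodMk contDiffAt_const)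
    exact (h2.clm_comp contDiffAt_const).contDiffWithinAt
  have hKfund : ∀ x ∈ e.target, ∀ A,
      K x A = dAt (E := EP) (E' := EP) e (e.symm x) (B.fund (e.symm x) A) := by
    intro x hx A
    have h1 : (dAt (E := EP) (E' := EP) e (e.symm x)).comp (B.fund (e.symm x))
        = dAt (E := EG) (E' := EP) (fun g : G => e (B.act (e.symm x) g)) 1 := by
      have := dAt_comp (E := EG) (E' := EP) (E'' := EP) (g := e)
        (f := fun g : G => B.act (e.symm x) g) 1
        ((hec _ (by rw [B.act_one]; exact e.map_target hx)).mdifferentiableAt (by simp))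
        ((B.smooth_act_left _ 1).mdifferentiableAt (by simp))
      rw [B.act_one] at this
      exact this.symm
    have hd : DifferentiableAt ℝ Φ (x, φ 1) := (hΦ x hx).differentiableAt (by simp)
    have hi : HasFDerivAt (fun y : EG => (x, y)) (ContinuousLinearMap.inr ℝ EP EG) (φ 1) :=
      hasFDerivAt_prodMk_right x (φ 1)
    have h2 : HasFDerivAt (fun y : EG => Φ (x, y))
        ((fderiv ℝ Φ (x, φ 1)).comp (ContinuousLinearMap.inr ℝ EP EG)) (φ 1) :=
      hd.hasFDerivAt.comp (φ 1) hi
    have h3 : dAt (E := EG) (E' := EP) (fun g : G => e (B.act (e.symm x) g)) 1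
        = dAt (E := EG) (E' := EP) ((fun y : EG => Φ (x, y)) ∘ φ) (1 : G) := by
      refine Filter.EventuallyEq.mfderiv_eq ?_
      filter_upwards [φ.open_source.mem_nhds hφ1] with g hg
      simp [Φ, φ.left_inv hg]
    have h4 := dAt_comp (E := EG) (E' := EG) (E'' := EP) (g := fun y : EG => Φ (x, y)) (f := φ)
      (1 : G) h2.differentiableAt.mdifferentiableAt (hφc.mdifferentiableAt (by simp))
    rw [dAt_eq_fderiv, h2.fderiv] at h4
    have h5 := DFunLike.congr_fun (h1.trans (h3.trans h4)) A
    exact h5.symm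
  have ha := hD.1.1.contDiffOn_toLin q
  have hrep := hD.1.1.contDiffOn q
  rw [← he] at ha hrep
  let a : EP → EP →L[ℝ] EG := fun x => toLin (chartRep D e x)
  have ha : ContDiffOn ℝ ∞ a e.target := ha
  let H : EP → EP →L[ℝ] EP := fun x => ContinuousLinearMap.id ℝ EP - (K x).comp (a x)
  have hH : ContDiffOn ℝ ∞ H e.target := contDiffOn_const.sub (hK.clm_comp ha)
  have hda : ContDiffOn ℝ ∞ (fderiv ℝ a) e.target :=
    ha.fderiv_of_isOpen e.open_target (by simp)
  have hHv : ∀ i, ContDiffOn ℝ ∞ (fun x => H x (v i)) e.target := fun i =>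
    hH.clm_apply contDiffOn_const
  have hfinal : ContDiffOn ℝ ∞ (fun x => fderiv ℝ a x (H x (v 0)) (H x (v 1))
      - fderiv ℝ a x (H x (v 1)) (H x (v 0))) e.target :=
    ((hda.clm_apply (hHv 0)).clm_apply (hHv 1)).sub ((hda.clm_apply (hHv 1)).clm_apply (hHv 0))
  refine hfinal.congr ?_
  intro x hx
  have hx' : e.symm x ∈ e.source := e.map_target hx
  have hmx : MDifferentiableAt 𝓘(ℝ, EP) 𝓘(ℝ, EP) e.symm x :=
    (hes x hx).mdifferentiableAt (by simp)
  have hme : MDifferentiableAt 𝓘(ℝ, EP) 𝓘(ℝ, EP) e (e.symm x) :=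
    (hec _ hx').mdifferentiableAt (by simp)
  have hinv1 : ∀ u, dAt (E := EP) (E' := EP) e (e.symm x)
      (dAt (E := EP) (E' := EP) e.symm x u) = u := by
    intro u
    have h1 := dAt_comp (E := EP) (E' := EP) (E'' := EP) x hme hmx
    have h2 : dAt (E := EP) (E' := EP) (e ∘ e.symm) x = ContinuousLinearMap.id ℝ EP := by
      rw [← dAt_id (E := EP) x]
      refine Filter.EventuallyEq.mfderiv_eq ?_
      filter_upwards [e.open_target.mem_nhds hx] with y hy
      simp [e.right_inv hy]
    exact (DFunLike.congr_fun (h1.symm.trans h2) u)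
  have hinv2 : ∀ u, dAt (E := EP) (E' := EP) e.symm x
      (dAt (E := EP) (E' := EP) e (e.symm x) u) = u := by
    intro u
    have hmx' : MDifferentiableAt 𝓘(ℝ, EP) 𝓘(ℝ, EP) e.symm (e (e.symm x)) := by
      rwa [e.right_inv hx]
    have h1 := dAt_comp (E := EP) (E' := EP) (E'' := EP) (e.symm x) hmx' hme
    rw [e.right_inv hx] at h1
    have h2 : dAt (E := EP) (E' := EP) (e.symm ∘ e) (e.symm x) = ContinuousLinearMap.id ℝ EP := by
      rw [← dAt_id (E := EP) (e.symm x)]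
      refine Filter.EventuallyEq.mfderiv_eq ?_
      filter_upwards [e.open_source.mem_nhds hx'] with y hy
      simp [e.left_inv hy]
    exact (DFunLike.congr_fun (h1.symm.trans h2) u)
  have hHx : ∀ u, dAt (E := EP) (E' := EP) e.symm x (H x u)
      = B.hor D (e.symm x) (dAt (E := EP) (E' := EP) e.symm x u) := by
    intro u
    have : a x u = toLin (D (e.symm x)) (dAt (E := EP) (E' := EP) e.symm x u) := rfl
    simp only [H, hor, sub_apply, ContinuousLinearMap.id_apply,
      ContinuousLinearMap.comp_apply, map_sub, hKfund x hx, hinv2, this]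
  have hext := extD_eq_chart D (fun q => (hD.1.1.contDiffOn q).differentiableOn (by simp))
    (p := e.symm x) (q := q) hx'
  rw [← he, e.right_inv hx] at hext
  have hdr : DifferentiableAt ℝ (chartRep D e) x :=
    (hrep.differentiableOn (by simp)).differentiableAt (e.open_target.mem_nhds hx)
  have h1 := extDeriv_one_apply hdr (fun i => H x (v i))
  refine Eq.trans ?_ h1
  rw [hext]
  simp only [chartRep, curvature, covD, ContinuousAlternatingMap.compContinuousLinearMap_apply,
    Function.comp_def, hHx]

theorem curvature_mem [FiniteDimensional ℝ EP] [FiniteDimensional ℝ EG]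
    [IsManifold 𝓘(ℝ, EP) ∞ P] [LieGroup 𝓘(ℝ, EG) ∞ G] {D : Form EP P EG 1} (hD : D ∈ B.Conn) :
    B.curvature D ∈ B.heForms 2 :=
  ⟨B.curvature_isSmooth hD, B.curvature_isHorizontal hD, B.curvature_isEquivariant hD⟩

/-- A gauge transformation: an automorphism of the principal bundle, i.e. an equivariant
diffeomorphism of the total space over the identity of the base. These form the group `Gau(P)`
under composition. -/
structure Gau where
  toDiffeo : Diffeomorph 𝓘(ℝ, EP) 𝓘(ℝ, EP) P P ∞
  equivariant : ∀ p g, toDiffeo (B.act p g) = B.act (toDiffeo p) g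
  over_id : ∀ p, B.proj (toDiffeo p) = B.proj p

/-- Two forms are gauge equivalent if they lie in the same orbit of the action of `Gau(P)` by
pullback. -/
def gaugeSetoid (k : ℕ) : Setoid (Form EP P EG k) where
  r a b := ∃ f : B.Gau, pullback (E := EP) (E' := EP) f.toDiffeo a = b
  iseqv := by
    refine ⟨fun a => ?_, ?_, ?_⟩
    · exact ⟨⟨Diffeomorph.refl _ _ _, fun _ _ => rfl, fun _ => rfl⟩, pullback_id a⟩
    · rintro a b ⟨f, rfl⟩
      refine ⟨⟨f.toDiffeo.symm, fun p g => ?_, fun p => ?_⟩, ?_⟩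
      · apply f.toDiffeo.injective
        change f.toDiffeo _ = f.toDiffeo _
        rw [f.equivariant, Diffeomorph.apply_symm_apply, Diffeomorph.apply_symm_apply]
      · rw [← f.over_id, Diffeomorph.apply_symm_apply]
      · rw [← pullback_comp (f.toDiffeo.mdifferentiable (by simp))
          (f.toDiffeo.symm.mdifferentiable (by simp))]
        have : (f.toDiffeo : P → P) ∘ f.toDiffeo.symm = id := by
          funext p; simp
        rw [this, pullback_id]
    · rintro a b c ⟨f, rfl⟩ ⟨f', rfl⟩
      refine ⟨⟨f'.toDiffeo.trans f.toDiffeo, fun p g => ?_, fun p => ?_⟩, ?_⟩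
      · simp [f.equivariant, f'.equivariant]
      · simp [f.over_id, f'.over_id]
      · rw [← pullback_comp (f.toDiffeo.mdifferentiable (by simp))
          (f'.toDiffeo.mdifferentiable (by simp))]
        rfl

/-- A set of `1`-forms is `Gau(P)`-invariant if it is stable under pullback along gauge
transformations. -/
def IsGaugeInvariant (X : Set (Form EP P EG 1)) : Prop :=
  ∀ f : B.Gau, ∀ a ∈ X, pullback (E := EP) (E' := EP) f.toDiffeo a ∈ X

/-- The orbit relation on a set of `1`-forms. -/
def orbitRel (X : Set (Form EP P EG 1)) : Setoid X := (B.gaugeSetoid 1).comap Subtype.val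

/-- The orbit space `X / Gau(P)`. -/
def OrbitSpace (X : Set (Form EP P EG 1)) := Quotient (B.orbitRel X)

/-- The projection `X → X / Gau(P)`. -/
def toOrbit (X : Set (Form EP P EG 1)) (a : X) : B.OrbitSpace X := Quotient.mk (B.orbitRel X) a

/-- The map `X / Gau(P) → Y / Gau(P)` induced by an inclusion `X ⊆ Y`. -/
def orbitIncl {X Y : Set (Form EP P EG 1)} (h : X ⊆ Y) : B.OrbitSpace X → B.OrbitSpace Y :=
  Quotient.map (Set.inclusion h) (fun _ _ hab => hab)

/-- `X` is a `Gau(P)`-invariant subset for the functional `S : X → ℝ`: `X` is invariant, and so is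
`S`. -/
def IsInvariantFor (X : Set (Form EP P EG 1)) (S : X → ℝ) : Prop :=
  B.IsGaugeInvariant X ∧
    ∀ (f : B.Gau) (a : X) (h : pullback (E := EP) (E' := EP) f.toDiffeo a.1 ∈ X), S ⟨_, h⟩ = S a

/-- The functional `X / Gau(P) → ℝ` induced by an invariant functional. -/
def inducedMap {X : Set (Form EP P EG 1)} {S : X → ℝ} (h : B.IsInvariantFor X S) :
    B.OrbitSpace X → ℝ :=
  Quotient.lift S (by
    rintro ⟨a, ha⟩ ⟨b, hb⟩ ⟨f, hf⟩
    dsimp only at hf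
    subst hf
    exact (h.2 f ⟨a, ha⟩ hb).symm)

/-- `X` is an injective `Gau(P)`-invariant subset for `S`: the induced functional on `X / Gau(P)`
is injective. -/
def IsInjectiveFor (X : Set (Form EP P EG 1)) (S : X → ℝ) : Prop :=
  ∃ h : B.IsInvariantFor X S, Function.Injective (B.inducedMap h)

/-- A gauge fixing in `X`: a global section of `X → X / Gau(P)`. -/
structure GaugeFixing (X : Set (Form EP P EG 1)) where
  toFun : B.OrbitSpace X → X
  isSection : ∀ o, B.toOrbit X (toFun o) = o

end PrincipalBundle

end Bundles

section Densities

variable {n : ℕ} {M : Type*} [TopologicalSpace M] [ChartedSpace (EuclideanSpace ℝ (Fin n)) M]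

/-- `Dens(M)`: the smooth `1`-densities on an `n`-manifold, as a real vector space. A density
assigns to `n` tangent vectors at a point a number which is multiplied by `|det A|` when an
endomorphism `A` of the tangent space is applied to the vectors. -/
def Dens (n : ℕ) (M : Type*) [TopologicalSpace M] [ChartedSpace (EuclideanSpace ℝ (Fin n)) M] :
    Submodule ℝ (M → (Fin n → EuclideanSpace ℝ (Fin n)) → ℝ) where
  carrier := {μ |
    (∀ (p : M) (A : EuclideanSpace ℝ (Fin n) →ₗ[ℝ] EuclideanSpace ℝ (Fin n)) v,
      μ p (fun i => A (v i)) = |LinearMap.det A| * μ p v) ∧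
    ∀ (q : M) (v : Fin n → EuclideanSpace ℝ (Fin n)),
      ContDiffOn ℝ ∞ (fun x => μ ((chartAt (EuclideanSpace ℝ (Fin n)) q).symm x) (fun i =>
        dAt (E := EuclideanSpace ℝ (Fin n)) (E' := EuclideanSpace ℝ (Fin n))
          (chartAt (EuclideanSpace ℝ (Fin n)) q).symm x (v i)))
        (chartAt (EuclideanSpace ℝ (Fin n)) q).target}
  zero_mem' := ⟨fun p A v => by simp, fun q v => contDiffOn_const (c := (0 : ℝ))⟩
  add_mem' := by
    rintro a b ⟨h1, h2⟩ ⟨k1, k2⟩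
    refine ⟨fun p A v => ?_, fun q v => (h2 q v).add (k2 q v)⟩
    simp only [Pi.add_apply, h1, k1]
    ring
  smul_mem' := by
    rintro c a ⟨h1, h2⟩
    refine ⟨fun p A v => ?_, fun q v => (h2 q v).const_smul c⟩
    simp only [Pi.smul_apply, smul_eq_mul, h1]
    ring

/-- A countable decomposition of `M` into disjoint Borel pieces `κ ⁻¹' {c}`, each of which lies in
the domain of the preferred chart at `c`. -/
structure IsChartSelection (n : ℕ) {M : Type*} [TopologicalSpace M]
    [ChartedSpace (EuclideanSpace ℝ (Fin n)) M] (κ : M → M) : Prop where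
  countable_range : (Set.range κ).Countable
  measurable : ∀ c, @MeasurableSet M (borel M) (κ ⁻¹' {c})
  mem_source : ∀ p, p ∈ (chartAt (EuclideanSpace ℝ (Fin n)) (κ p)).source

theorem exists_isChartSelection (n : ℕ) (M : Type*) [TopologicalSpace M]
    [ChartedSpace (EuclideanSpace ℝ (Fin n)) M] [SecondCountableTopology M] :
    ∃ κ : M → M, IsChartSelection n κ := by
  classical
  let _ : MeasurableSpace M := borel M
  have _ : BorelSpace M := ⟨rfl⟩
  let U : M → Set M := fun c => (chartAt (EuclideanSpace ℝ (Fin n)) c).source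
  have hU : ∀ c, IsOpen (U c) := fun c => (chartAt (EuclideanSpace ℝ (Fin n)) c).open_source
  obtain ⟨s, hs, hcov⟩ := TopologicalSpace.countable_cover_nhds (f := U)
    (fun c => (hU c).mem_nhds (mem_chart_source _ c))
  have := hs.to_subtype
  obtain ⟨idx, hidx⟩ := exists_injective_nat s
  have hex : ∀ p : M, ∃ k : ℕ, ∃ c : s, idx c = k ∧ p ∈ U c := by
    intro p
    have : p ∈ ⋃ c ∈ s, U c := by rw [hcov]; trivial
    simp only [mem_iUnion] at this
    obtain ⟨c, hc, hp⟩ := this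
    exact ⟨idx ⟨c, hc⟩, ⟨c, hc⟩, rfl, hp⟩
  let κ : M → M := fun p => (Nat.find_spec (hex p)).choose
  have hκ1 : ∀ p, ∃ c : s, (c : M) = κ p ∧ idx c = Nat.find (hex p) ∧ p ∈ U c := fun p =>
    ⟨_, rfl, (Nat.find_spec (hex p)).choose_spec⟩
  refine ⟨κ, ?_, ?_, ?_⟩
  · refine hs.mono ?_
    rintro _ ⟨p, rfl⟩
    obtain ⟨c, hc, -⟩ := hκ1 p
    rw [← hc]; exact c.2
  · intro c
    by_cases hc : c ∈ s
    · have : κ ⁻¹' {c} = U c \ ⋃ c' : {c' : s // idx c' < idx ⟨c, hc⟩}, U c'.1 := by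
        ext p
        obtain ⟨d, hd1, hd2, hd3⟩ := hκ1 p
        simp only [mem_preimage, mem_singleton_iff, mem_sdiff, mem_iUnion, not_exists]
        constructor
        · intro h
          have hdc : d = ⟨c, hc⟩ := Subtype.ext (hd1.trans h)
          subst hdc
          refine ⟨hd3, fun c' hp => ?_⟩
          have := Nat.find_min' (hex p) ⟨c'.1, rfl, hp⟩
          have := c'.2
          omega
        · rintro ⟨h1, h2⟩
          have h3 : Nat.find (hex p) ≤ idx ⟨c, hc⟩ := Nat.find_min' (hex p) ⟨⟨c, hc⟩, rfl, h1⟩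
          have h4 : ¬ idx d < idx ⟨c, hc⟩ := fun hlt => h2 ⟨d, hlt⟩ hd3
          have h5 : d = ⟨c, hc⟩ := hidx (by omega)
          rw [← hd1, h5]
      rw [this]
      exact (hU c).measurableSet.diff (MeasurableSet.iUnion fun c' => (hU _).measurableSet)
    · have : κ ⁻¹' {c} = ∅ := by
        ext p
        obtain ⟨d, hd1, -⟩ := hκ1 p
        simp only [mem_preimage, mem_singleton_iff, mem_empty_iff_false, iff_false]
        intro h
        exact hc (h ▸ hd1 ▸ d.2)
      rw [this]
      exact MeasurableSet.empty
  · intro p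
    obtain ⟨d, hd1, -, hd3⟩ := hκ1 p
    rw [← hd1]
    exact hd3

/-- A fixed decomposition of `M` into pieces of chart domains. -/
def chartSelection (n : ℕ) (M : Type*) [TopologicalSpace M]
    [ChartedSpace (EuclideanSpace ℝ (Fin n)) M] [SecondCountableTopology M] : M → M :=
  (exists_isChartSelection n M).choose

/-- The coordinate function of a density in the preferred chart at `c`, i.e. its value on the
coordinate frame. -/
def densCoord (μ : M → (Fin n → EuclideanSpace ℝ (Fin n)) → ℝ) (c : M)
    (x : EuclideanSpace ℝ (Fin n)) : ℝ :=
  μ ((chartAt (EuclideanSpace ℝ (Fin n)) c).symm x) (fun i =>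
    dAt (E := EuclideanSpace ℝ (Fin n)) (E' := EuclideanSpace ℝ (Fin n))
      (chartAt (EuclideanSpace ℝ (Fin n)) c).symm x (EuclideanSpace.single i 1))

/-- The part of the decomposition lying in the preferred chart at `c`, in coordinates. -/
def chartPiece [SecondCountableTopology M] (c : M) : Set (EuclideanSpace ℝ (Fin n)) :=
  chartAt (EuclideanSpace ℝ (Fin n)) c '' (chartSelection n M ⁻¹' {c})

/-- Absolute integrability of a density over `M`. -/
def DensIntegrable [SecondCountableTopology M]
    (μ : M → (Fin n → EuclideanSpace ℝ (Fin n)) → ℝ) : Prop :=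
  (∀ c : M, MeasureTheory.IntegrableOn (densCoord μ c) (chartPiece c)) ∧
    Summable (fun c : M => ∫ x in chartPiece c, |densCoord μ c x|)

/-- The integral `∫_M μ` of a density: the sum of the Lebesgue integrals of its coordinate
functions over the pieces of a decomposition of `M` subordinate to charts. For absolutely
integrable densities it does not depend on the decomposition. -/
def densIntegral [SecondCountableTopology M]
    (μ : M → (Fin n → EuclideanSpace ℝ (Fin n)) → ℝ) : ℝ :=
  ∑' c : M, ∫ x in chartPiece c, densCoord μ c x

end Densities

section BasicExtensions

/-- A basic extension of the Lie group `G`: an injective Lie group homomorphism `G → Ĝ`. -/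
structure BasicExtension (EG EG' G G' : Type*)
    [NormedAddCommGroup EG] [NormedSpace ℝ EG] [NormedAddCommGroup EG'] [NormedSpace ℝ EG']
    [TopologicalSpace G] [ChartedSpace EG G] [Group G]
    [TopologicalSpace G'] [ChartedSpace EG' G'] [Group G'] where
  toHom : G →* G'
  smooth : ContMDiff 𝓘(ℝ, EG) 𝓘(ℝ, EG') ∞ toHom
  injective : Function.Injective toHom

/-- The principal `Ĝ`-bundle `B' : P̂ → M` is the one induced from `B : P → M` by the basic extension
`ι : G → Ĝ`: there is given an `ι`-equivariant smooth bundle map `P → P̂` over the identity of `M`.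
This determines `P̂` up to unique isomorphism under `P`; it is the associated bundle `P ×_G Ĝ`
(see `InducedBundle.exists_eq_act` and `InducedBundle.act_eq_act_iff`). -/
structure InducedBundle {EM EG EP EG' EP' M G P G' P' : Type*}
    [NormedAddCommGroup EM] [NormedSpace ℝ EM] [TopologicalSpace M] [ChartedSpace EM M]
    [NormedAddCommGroup EG] [NormedSpace ℝ EG] [NormedAddCommGroup EP] [NormedSpace ℝ EP]
    [TopologicalSpace G] [ChartedSpace EG G] [Group G] [TopologicalSpace P] [ChartedSpace EP P]
    [NormedAddCommGroup EG'] [NormedSpace ℝ EG'] [NormedAddCommGroup EP'] [NormedSpace ℝ EP']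
    [TopologicalSpace G'] [ChartedSpace EG' G'] [Group G'] [TopologicalSpace P']
    [ChartedSpace EP' P']
    (B : PrincipalBundle EM EG EP M G P) (ι : BasicExtension EG EG' G G')
    (B' : PrincipalBundle EM EG' EP' M G' P') where
  emb : P → P'
  smooth_emb : ContMDiff 𝓘(ℝ, EP) 𝓘(ℝ, EP') ∞ emb
  proj_emb : ∀ p, B'.proj (emb p) = B.proj p
  emb_act : ∀ p g, emb (B.act p g) = B'.act (emb p) (ι.toHom g)

namespace InducedBundle

variable {EM EG EP EG' EP' M G P G' P' : Type*}
  [NormedAddCommGroup EM] [NormedSpace ℝ EM] [TopologicalSpace M] [ChartedSpace EM M]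
  [NormedAddCommGroup EG] [NormedSpace ℝ EG] [NormedAddCommGroup EP] [NormedSpace ℝ EP]
  [TopologicalSpace G] [ChartedSpace EG G] [Group G] [TopologicalSpace P] [ChartedSpace EP P]
  [NormedAddCommGroup EG'] [NormedSpace ℝ EG'] [NormedAddCommGroup EP'] [NormedSpace ℝ EP']
  [TopologicalSpace G'] [ChartedSpace EG' G'] [Group G'] [TopologicalSpace P'] [ChartedSpace EP' P']
  {B : PrincipalBundle EM EG EP M G P} {ι : BasicExtension EG EG' G G'}
  {B' : PrincipalBundle EM EG' EP' M G' P'}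

/-- Every point of `P̂` is of the form `p · h` with `p ∈ P`, `h ∈ Ĝ`. -/
theorem exists_eq_act (J : InducedBundle B ι B') (y : P') :
    ∃ (p : P) (h : G'), y = B'.act (J.emb p) h := by
  obtain ⟨p, hp⟩ := B.surjective_proj (B'.proj y)
  obtain ⟨h, hh⟩ := B'.exists_eq_act (p := J.emb p) (q := y) (by rw [J.proj_emb, hp])
  exact ⟨p, h, hh⟩

/-- The fibres of `P × Ĝ → P̂`, `(p, h) ↦ p · h`, are the classes of the relation
`(p · g, h) ∼ (p, ι(g) h)`, i.e. `P̂ = P ×_G Ĝ`. -/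
theorem act_eq_act_iff (J : InducedBundle B ι B') (p q : P) (h k : G') :
    B'.act (J.emb p) h = B'.act (J.emb q) k ↔ ∃ g, q = B.act p g ∧ h = ι.toHom g * k := by
  constructor
  · intro e
    have e1 := congrArg B'.proj e
    rw [B'.proj_act, B'.proj_act, J.proj_emb, J.proj_emb] at e1
    obtain ⟨g, rfl⟩ := B.exists_eq_act e1
    refine ⟨g, rfl, ?_⟩
    rw [J.emb_act, ← B'.act_mul] at e
    exact B'.act_free e
  · rintro ⟨g, rfl, rfl⟩
    rw [J.emb_act, B'.act_mul]

end InducedBundle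

end BasicExtensions

section Theories

variable {n : ℕ} {EG EP EG' EP' M G P G' P' : Type*}
  [TopologicalSpace M] [ChartedSpace (EuclideanSpace ℝ (Fin n)) M] [SecondCountableTopology M]
  [NormedAddCommGroup EG] [NormedSpace ℝ EG] [FiniteDimensional ℝ EG]
  [TopologicalSpace G] [ChartedSpace EG G] [Group G] [LieGroup 𝓘(ℝ, EG) ∞ G]
  [NormedAddCommGroup EP] [NormedSpace ℝ EP] [FiniteDimensional ℝ EP]
  [TopologicalSpace P] [ChartedSpace EP P] [IsManifold 𝓘(ℝ, EP) ∞ P]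
  [NormedAddCommGroup EG'] [NormedSpace ℝ EG']
  [TopologicalSpace G'] [ChartedSpace EG' G'] [Group G']
  [NormedAddCommGroup EP'] [NormedSpace ℝ EP']
  [TopologicalSpace P'] [ChartedSpace EP' P']

/-- A Yang-Mills-type theory with instanton sector `B`: a real bilinear pairing
`Ω²_he(P; 𝔤) × Ω²_he(P; 𝔤) → Dens(M)` for which the densities `⟨F_D, F_D⟩` are integrable (so that
the action functional is real-valued; this is automatic if `M` is compact). -/
structure Theory (B : PrincipalBundle (EuclideanSpace ℝ (Fin n)) EG EP M G P) where
  pairing : B.heForms 2 →ₗ[ℝ] B.heForms 2 →ₗ[ℝ] Dens n M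
  integrable : ∀ D : B.Conn, DensIntegrable
    (pairing ⟨B.curvature D.1, B.curvature_mem D.2⟩ ⟨B.curvature D.1, B.curvature_mem D.2⟩).1

/-- The action functional `S^G(D) = ∫_M ⟨F_D, F_D⟩`. -/
def Theory.action {B : PrincipalBundle (EuclideanSpace ℝ (Fin n)) EG EP M G P} (T : Theory B)
    (D : B.Conn) : ℝ :=
  densIntegral
    (T.pairing ⟨B.curvature D.1, B.curvature_mem D.2⟩ ⟨B.curvature D.1, B.curvature_mem D.2⟩).1

/-- An extension of the Yang-Mills-type theory `T` relative to a basic extension, with induced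
bundle `B'`. -/
structure Extension {B : PrincipalBundle (EuclideanSpace ℝ (Fin n)) EG EP M G P} (T : Theory B)
    {ι : BasicExtension EG EG' G G'}
    {B' : PrincipalBundle (EuclideanSpace ℝ (Fin n)) EG' EP' M G' P'}
    (J : InducedBundle B ι B') where
  /-- the extended domain -/
  domain : Set (Form EP' P' EG' 1)
  conn_subset : B'.Conn ⊆ domain
  subset_eq : domain ⊆ B'.eqOneForms
  /-- the extended action functional -/
  functional : domain → ℝ
  invariant : B'.IsInvariantFor domain functional
  /-- the correction subspace -/
  corrSpace : Set (Form EP' P' EG' 1)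
  corr_subset : corrSpace ⊆ domain
  /-- the correction functional -/
  correction : corrSpace → ℝ
  delta : corrSpace → B.Conn
  decomposition : ∀ a : corrSpace,
    functional ⟨a.1, corr_subset a.2⟩ = T.action (delta a) + correction a

section Pullback

variable {B : PrincipalBundle (EuclideanSpace ℝ (Fin n)) EG EP M G P} (T : Theory B)
  {B' : PrincipalBundle (EuclideanSpace ℝ (Fin n)) EG' EP' M G' P'}
  {X : Set (Form EP' P' EG' 1)} (hX : B'.Conn ⊆ X) {S : X → ℝ} (hS : B'.IsInvariantFor X S)

/-- `Pb(S^G, S̄_{0,j})`: the pullback of the action functional `S^G : Conn(P; 𝔤) → ℝ` and the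
functional `Conn(P̂; 𝔤̂)/Gau(P̂) → X/Gau(P̂) → ℝ` induced by `S`. -/
def Pb : Type _ :=
  Function.Pullback T.action (fun o : B'.OrbitSpace B'.Conn => B'.inducedMap hS (B'.orbitIncl hX o))

/-- The subset `X(σ) ⊆ X`: the image of the pullback under
`Pb → Conn(P̂; 𝔤̂)/Gau(P̂) → Conn(P̂; 𝔤̂) ⊆ X`, the second map being the gauge fixing `σ`. -/
def gaugeSlice (σ : B'.GaugeFixing B'.Conn) : Set (Form EP' P' EG' 1) :=
  Set.range (fun z : Pb T hX hS => (σ.toFun z.1.2 : Form EP' P' EG' 1))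

end Pullback

namespace Extension

variable {B : PrincipalBundle (EuclideanSpace ℝ (Fin n)) EG EP M G P} {T : Theory B}
  {ι : BasicExtension EG EG' G G'}
  {B' : PrincipalBundle (EuclideanSpace ℝ (Fin n)) EG' EP' M G' P'}
  {J : InducedBundle B ι B'}

/-- An extension is complete if its correction functional vanishes. -/
def IsComplete (E : Extension T J) : Prop := ∀ a, E.correction a = 0

/-- An extension is injective if its domain is an injective `Gau(P̂)`-invariant subset for its
functional. -/
def IsInjective (E : Extension T J) : Prop := B'.IsInjectiveFor E.domain E.functional

/-- An extension is of pullback type if it is complete, its domain is an injective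
`Gau(P̂)`-invariant subset `X` for its functional, and its correction subspace lies in `X(σ)` for
some gauge fixing `σ` in `Conn(P̂; 𝔤̂)`. -/
def IsPullbackType (E : Extension T J) : Prop :=
  E.IsComplete ∧ E.IsInjective ∧
    ∃ σ : B'.GaugeFixing B'.Conn, E.corrSpace ⊆ gaugeSlice T E.conn_subset E.invariant σ

/-- The extension `E` realizes the functional `S : X → ℝ`: its domain is `X` and its extended action
functional is `S`. -/
def Realizes (E : Extension T J) (X : Set (Form EP' P' EG' 1)) (S : X → ℝ) : Prop :=
  ∃ h : E.domain = X, ∀ a : E.domain, E.functional a = S ⟨a.1, h ▸ a.2⟩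

end Extension

section Classes

variable {B : PrincipalBundle (EuclideanSpace ℝ (Fin n)) EG EP M G P} (T : Theory B)
  {ι : BasicExtension EG EG' G G'}
  {B' : PrincipalBundle (EuclideanSpace ℝ (Fin n)) EG' EP' M G' P'}
  (J : InducedBundle B ι B')

/-- The class `Inj(S^G; Ĝ)` of injective extensions. -/
def Inj : Set (Extension T J) := {E | E.IsInjective}

/-- The class `Pb(S^G; Ĝ)` of pullback-type extensions. -/
def PbClass : Set (Extension T J) := {E | E.IsPullbackType}

/-- The class `Coh(S^G; Ĝ) = Inj(S^G; Ĝ) ∩ Pb(S^G; Ĝ)` of coherent extensions. -/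
def Coh : Set (Extension T J) := Inj T J ∩ PbClass T J

end Classes

end Theories

end YangMillsType

end

-- The heart of the matter is the construction of an extension whose correction subspace is all of
-- $X(\sigma)$. A point of $X(\sigma)$ is $\sigma(o)$ for some pair $(D,o)$ of the pullback, so it
-- comes with a connection $D$ on $P$ with $S^G(D)=\overline S_{\jmath}(o)$. Since $\sigma(o)$
-- represents the orbit $o$ and $S$ is constant on orbits, $\overline S_{\jmath}(o)=S(\sigma(o))$.
-- Hence $S(\sigma(o))=S^G(D)$: taking $\delta(\sigma(o))=D$ gives the required decomposition of $S$
-- on $X(\sigma)$ with $C=0$. This argument is carried by `inducedMap_orbitIncl_eq` and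
-- `exists_action_eq`, and packaged in `gaugeSliceExtension`.
--
-- The construction asks only for invariance of $S$. Injectivity enters when the extension is placed
-- in the classes: it is the defining condition of `Inj` and also one clause of pullback type. With
-- completeness and $C^1=X(\sigma)$ holding by construction, an injective $S$ gives a member of
-- `Coh`, which is the third claim.
--
-- The other two claims follow from a cycle of implications: realized in `Coh`, realized in `Inj`,
-- $X$ injective invariant for $S$, realized in `Coh`. The first arrow is an inclusion of classes.
-- The second holds because injectivity of an extension speaks only of its domain and functional,
-- which are $X$ and $S$ (`isInjectiveFor_of_realizes`). The third is the construction above for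
-- some gauge fixing, and one exists by the axiom of choice (`nonempty_gaugeFixing`). Curvature,
-- pairing and integration play a role only through the real-valued function `T.action`.

namespace YangMillsType

-- Gauge fixings and functionals on orbit spaces.

section Orbits

variable {EM EG EP M G P : Type*}
  [NormedAddCommGroup EM] [NormedSpace ℝ EM] [NormedAddCommGroup EG] [NormedSpace ℝ EG]
  [NormedAddCommGroup EP] [NormedSpace ℝ EP]
  [TopologicalSpace M] [ChartedSpace EM M]
  [TopologicalSpace G] [ChartedSpace EG G] [Group G]
  [TopologicalSpace P] [ChartedSpace EP P]

namespace PrincipalBundle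

variable (B : PrincipalBundle EM EG EP M G P)

/-- The axiom of choice provides a gauge fixing in every set of `1`-forms. -/
theorem nonempty_gaugeFixing (X : Set (Form EP P EG 1)) : Nonempty (B.GaugeFixing X) :=
  ⟨⟨Quotient.out, Quotient.out_eq⟩⟩

/-- The functional induced by `S` on the orbits of a subset `Y ⊆ X` is computed on the
representatives chosen by any gauge fixing. -/
theorem inducedMap_orbitIncl_eq {X Y : Set (Form EP P EG 1)} (hY : Y ⊆ X) {S : X → ℝ}
    (hS : B.IsInvariantFor X S) (σ : B.GaugeFixing Y) (o : B.OrbitSpace Y) :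
    B.inducedMap hS (B.orbitIncl hY o) = S (Set.inclusion hY (σ.toFun o)) := by
  -- Once $o$ is written as the class of $\sigma(o)$, the inclusion of orbit spaces and the lifted
  -- functional both compute on that representative, so the two sides agree by definition. The
  -- rewrite is confined to the left because $o$ also occurs inside $\sigma(o)$ on the right.
  conv_lhs => rw [← σ.isSection o]
  rfl

end PrincipalBundle

end Orbits

-- The extension with correction subspace $X(\sigma)$ and its coherence.

section Coherent

variable {n : ℕ} {EG EP EG' EP' M G P G' P' : Type*}
  [TopologicalSpace M] [ChartedSpace (EuclideanSpace ℝ (Fin n)) M] [SecondCountableTopology M]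
  [NormedAddCommGroup EG] [NormedSpace ℝ EG] [FiniteDimensional ℝ EG]
  [TopologicalSpace G] [ChartedSpace EG G] [Group G] [LieGroup 𝓘(ℝ, EG) ∞ G]
  [NormedAddCommGroup EP] [NormedSpace ℝ EP] [FiniteDimensional ℝ EP]
  [TopologicalSpace P] [ChartedSpace EP P] [IsManifold 𝓘(ℝ, EP) ∞ P]
  [NormedAddCommGroup EG'] [NormedSpace ℝ EG']
  [TopologicalSpace G'] [ChartedSpace EG' G'] [Group G']
  [NormedAddCommGroup EP'] [NormedSpace ℝ EP']
  [TopologicalSpace P'] [ChartedSpace EP' P']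
  {B : PrincipalBundle (EuclideanSpace ℝ (Fin n)) EG EP M G P}
  {ι : BasicExtension EG EG' G G'}
  {B' : PrincipalBundle (EuclideanSpace ℝ (Fin n)) EG' EP' M G' P'}

theorem gaugeSlice_subset (T : Theory B) {X : Set (Form EP' P' EG' 1)} (hX : B'.Conn ⊆ X)
    {S : X → ℝ} (hS : B'.IsInvariantFor X S) (σ : B'.GaugeFixing B'.Conn) :
    gaugeSlice T hX hS σ ⊆ X := by
  rintro _ ⟨z, rfl⟩
  exact hX (σ.toFun z.1.2).2

/-- On `X(σ)` the functional `S` takes values of the action functional. -/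
theorem exists_action_eq (T : Theory B) {X : Set (Form EP' P' EG' 1)} (hX : B'.Conn ⊆ X)
    {S : X → ℝ} (hS : B'.IsInvariantFor X S) (σ : B'.GaugeFixing B'.Conn)
    (a : gaugeSlice T hX hS σ) :
    ∃ D : B.Conn, S ⟨a.1, gaugeSlice_subset T hX hS σ a.2⟩ = T.action D := by
  obtain ⟨_, z, rfl⟩ := a
  -- Here `z.1` is the pair $(D,o)$ and `z.2` the equation $S^G(D)=\overline S_{\jmath}(o)$ that
  -- defines the pullback; the witness is its first coordinate $D$.
  exact ⟨z.1.1, (z.2.trans (B'.inducedMap_orbitIncl_eq hX hS σ z.1.2)).symm⟩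

/-- The extension with functional `S` and correction subspace `X(σ)`, in which `δ` chooses a
connection of the same action and the correction functional vanishes. -/
noncomputable def gaugeSliceExtension (T : Theory B) (J : InducedBundle B ι B')
    {X : Set (Form EP' P' EG' 1)} (hX : B'.Conn ⊆ X) (hX' : X ⊆ B'.eqOneForms)
    {S : X → ℝ} (hS : B'.IsInvariantFor X S) (σ : B'.GaugeFixing B'.Conn) : Extension T J where
  domain := X
  conn_subset := hX
  subset_eq := hX'
  functional := S
  invariant := hS
  corrSpace := gaugeSlice T hX hS σ
  corr_subset := gaugeSlice_subset T hX hS σ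
  correction := 0
  -- Many connections can have the same action, so $D$ is not determined by $a=\sigma(o)$. The
  -- choice is made for each point $a$ of $X(\sigma)$, not for each pair $(D,o)$, which makes
  -- $\delta$ a function on $X(\sigma)$. If the pullback is empty, so is $X(\sigma)$, and nothing
  -- has to be chosen.
  delta a := (exists_action_eq T hX hS σ a).choose
  decomposition a := by
    simpa using (exists_action_eq T hX hS σ a).choose_spec

/-- The correction subspace is the largest one that pullback type allows for $\sigma$, so the
inclusion into $X(\sigma)$ is reflexivity, and completeness is the zero correction. Only injectivity
has to be supplied from outside. -/
theorem gaugeSliceExtension_mem_Coh (T : Theory B) (J : InducedBundle B ι B')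
    {X : Set (Form EP' P' EG' 1)} (hX : B'.Conn ⊆ X) (hX' : X ⊆ B'.eqOneForms)
    {S : X → ℝ} (hS : B'.IsInvariantFor X S) (hinj : Function.Injective (B'.inducedMap hS))
    (σ : B'.GaugeFixing B'.Conn) : gaugeSliceExtension T J hX hX' hS σ ∈ Coh T J :=
  -- The pair `⟨hS, hinj⟩` occurs twice: for membership in `Inj` and for the injectivity clause of
  -- pullback type.
  ⟨⟨hS, hinj⟩, fun _ => rfl, ⟨hS, hinj⟩, σ, Set.Subset.rfl⟩

/-- Correction data play no part in injectivity, so the property passes from the extension to the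
bare pair $(X,S)$. The domains are identified before the functionals: only then do `E.functional`
and `S` have the same type and can be equated by `funext`. -/
theorem Extension.IsInjective.isInjectiveFor_of_realizes {T : Theory B} {J : InducedBundle B ι B'}
    {E : Extension T J} (hE : E.IsInjective) {X : Set (Form EP' P' EG' 1)} {S : X → ℝ}
    (h : E.Realizes X S) : B'.IsInjectiveFor X S := by
  obtain ⟨rfl, hS⟩ := h
  obtain rfl : E.functional = S := funext hS
  exact hE

end Coherent

end YangMillsType

-- The obstruction for coherent extensions.

theorem mainTheorem10 {n : ℕ} {EG EP EG' EP' M G P G' P' : Type*}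
    [TopologicalSpace M] [T2Space M] [SecondCountableTopology M]
    [ChartedSpace (EuclideanSpace ℝ (Fin n)) M] [IsManifold 𝓘(ℝ, EuclideanSpace ℝ (Fin n)) ∞ M]
    [NormedAddCommGroup EG] [NormedSpace ℝ EG] [FiniteDimensional ℝ EG]
    [TopologicalSpace G] [ChartedSpace EG G] [Group G] [LieGroup 𝓘(ℝ, EG) ∞ G]
    [NormedAddCommGroup EP] [NormedSpace ℝ EP] [FiniteDimensional ℝ EP]
    [TopologicalSpace P] [ChartedSpace EP P] [IsManifold 𝓘(ℝ, EP) ∞ P]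
    [NormedAddCommGroup EG'] [NormedSpace ℝ EG'] [FiniteDimensional ℝ EG']
    [TopologicalSpace G'] [ChartedSpace EG' G'] [Group G'] [LieGroup 𝓘(ℝ, EG') ∞ G']
    [NormedAddCommGroup EP'] [NormedSpace ℝ EP'] [FiniteDimensional ℝ EP']
    [TopologicalSpace P'] [ChartedSpace EP' P'] [IsManifold 𝓘(ℝ, EP') ∞ P']
    (B : YangMillsType.PrincipalBundle (EuclideanSpace ℝ (Fin n)) EG EP M G P)
    (T : YangMillsType.Theory B)
    (ι : YangMillsType.BasicExtension EG EG' G G')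
    (B' : YangMillsType.PrincipalBundle (EuclideanSpace ℝ (Fin n)) EG' EP' M G' P')
    (J : YangMillsType.InducedBundle B ι B')
    (X : Set (YangMillsType.Form EP' P' EG' 1)) (hX : B'.Conn ⊆ X) (hX' : X ⊆ B'.eqOneForms)
    (S : X → ℝ) :
    ((∃ E ∈ YangMillsType.Coh T J, E.Realizes X S) ↔
      ∃ E ∈ YangMillsType.Inj T J, E.Realizes X S) ∧
    ((∃ E ∈ YangMillsType.Inj T J, E.Realizes X S) ↔ B'.IsInjectiveFor X S) ∧
    (∀ (hS : B'.IsInvariantFor X S), Function.Injective (B'.inducedMap hS) →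
      ∀ σ : B'.GaugeFixing B'.Conn, ∃ E ∈ YangMillsType.Coh T J,
        E.Realizes X S ∧ E.corrSpace = YangMillsType.gaugeSlice T hX hS σ) := by
  -- The third claim is proved before the others, since it supplies the existence statement that
  -- they need.
  have coh : ∀ (hS : B'.IsInvariantFor X S), Function.Injective (B'.inducedMap hS) →
      ∀ σ : B'.GaugeFixing B'.Conn, ∃ E ∈ YangMillsType.Coh T J,
        E.Realizes X S ∧ E.corrSpace = YangMillsType.gaugeSlice T hX hS σ :=
    fun hS hinj σ => ⟨YangMillsType.gaugeSliceExtension T J hX hX' hS σ,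
      YangMillsType.gaugeSliceExtension_mem_Coh T J hX hX' hS hinj σ, ⟨rfl, fun _ => rfl⟩, rfl⟩
  have injFor_of_inj : (∃ E ∈ YangMillsType.Inj T J, E.Realizes X S) → B'.IsInjectiveFor X S := by
    rintro ⟨E, hE, hr⟩
    exact YangMillsType.Extension.IsInjective.isInjectiveFor_of_realizes hE hr
  have coh_of_injFor : B'.IsInjectiveFor X S → ∃ E ∈ YangMillsType.Coh T J, E.Realizes X S := by
    rintro ⟨hS, hinj⟩
    -- Any gauge fixing will do, as pullback type asks only for some $\sigma$; the precise
    -- correction subspace is then forgotten.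
    obtain ⟨σ⟩ := B'.nonempty_gaugeFixing B'.Conn
    obtain ⟨E, hE, hr, -⟩ := coh hS hinj σ
    exact ⟨E, hE, hr⟩
  have inj_of_coh : (∃ E ∈ YangMillsType.Coh T J, E.Realizes X S) →
      ∃ E ∈ YangMillsType.Inj T J, E.Realizes X S :=
    fun ⟨E, hE, hr⟩ => ⟨E, hE.1, hr⟩
  -- Both equivalences are read off the cycle of three implications, each converse being a composite
  -- of the other two.
  exact ⟨⟨inj_of_coh, fun h => coh_of_injFor (injFor_of_inj h)⟩,
    ⟨injFor_of_inj, fun h => inj_of_coh (coh_of_injFor h)⟩, coh⟩
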